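/- Let $A$ be a finite totally ordered set, let $\mathbb P=\{1,2,3,\dots\}$, and order $\mathbb P^2$ by the partial order $\preceq$ whose covering relations are $(1,y)\prec(1,y+1)$ and $(x,y)\prec(x+1,y)$ for all $x,y\in\mathbb P$. An *ideal* is a finite lower set of $(\mathbb P^2,\preceq)$. A *skew ideal* is a set $I\setminus J$ with $J\subseteq I$ ideals. An *$A$-labelling* of a finite subset of $\mathbb P^2$ is an increasing bijection from it onto $A$. A *skew partition* is an $A$-labelling of a skew ideal $I\setminus J$; it is called a *partition* if $J=\emptyset$. (Partitions in this sense correspond bijectively to set partitions of $A$, the blocks being the sets of labels of the rows $y=1,2,\dots$.) A *downward slide* on a skew partition with shape $I\setminus J$, $J\neq\emptyset$, is the following: choose a maximal element $H$ of $J$ and regard $H$ as an unlabelled hole in $S=(I\setminus J)\cup\{H\}$. While the hole $h$ is covered by some point of $S$, let $K$ be the point of $S$ with the smallest label among those covering $h$; move the label of $K$ to $h$, and let $K$ be the new hole. When no point of $S$ covers the hole $h$ (equivalently, $I\setminus\{h\}$ is an ideal), delete it from the shape; the result has shape $(I\setminus\{h\})\setminus(J\setminus\{H\})$. *Downward jeu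 de taquin* consists in applying downward slides repeatedly, with arbitrary choices of $H$, until a partition is obtained. **Theorem.** Let $R$ be a skew partition. In every run of downward jeu de taquin on $R$, whatever the choices, each slide ends after finitely many moves and produces a well-defined skew partition, and the run ends after finitely many slides with a partition. This final partition does not depend on the choices of the points $H$ made during the slides: exactly one partition can be obtained from $R$. It does not depend either on the choice of the ideals $I,J$ used to write the labelled skew ideal of $R$ as a difference $I\setminus J$. -/

import Mathlib

/-- Points of the set of pairs of positive integers: `x` is the column, `y` is the row. -/
@[ext]
structure PosPair where
  x : ℕ+
  y : ℕ+
  deriving DecidableEq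

namespace PosPair

/-- The two kinds of elementary upward steps: `(1, y) → (1, y + 1)` and `(x, y) → (x + 1, y)`. -/
def Step (p q : PosPair) : Prop :=
  (p.x = 1 ∧ q.x = 1 ∧ q.y = p.y + 1) ∨ (q.y = p.y ∧ q.x = p.x + 1)

/-- The order `⪯`: one goes up inside the first column, then to the right inside a row.
It is the reflexive transitive closure of `Step` (see `le_iff_reflTransGen`) and its covering
relation is `Step` (see `covBy_iff`). -/
instance : PartialOrder PosPair where
  le p q := (p.y = q.y ∧ p.x ≤ q.x) ∨ (p.x = 1 ∧ p.y ≤ q.y)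
  le_refl p := Or.inl ⟨rfl, le_refl _⟩
  le_trans p q r := by
    rintro (⟨h1, h2⟩ | ⟨h1, h2⟩) (⟨h3, h4⟩ | ⟨h3, h4⟩)
    · exact Or.inl ⟨h1.trans h3, h2.trans h4⟩
    · exact Or.inr ⟨le_antisymm (h3 ▸ h2) (one_le), h1 ▸ h4⟩
    · exact Or.inr ⟨h1, h3 ▸ h2⟩
    · exact Or.inr ⟨h1, h2.trans h4⟩
  le_antisymm p q := by
    rintro (⟨h1, h2⟩ | ⟨h1, h2⟩) (⟨h3, h4⟩ | ⟨h3, h4⟩)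
    · exact PosPair.ext (le_antisymm h2 h4) h1
    · exact PosPair.ext (le_antisymm h2 (h3 ▸ one_le)) h1
    · exact PosPair.ext (le_antisymm (h1 ▸ one_le) h4) h3.symm
    · exact PosPair.ext (h1.trans h3.symm) (le_antisymm h2 h4)

theorem le_def (p q : PosPair) :
    p ≤ q ↔ (p.y = q.y ∧ p.x ≤ q.x) ∨ (p.x = 1 ∧ p.y ≤ q.y) := Iff.rfl

theorem Step.lt {p q : PosPair} (h : Step p q) : p < q := by
  refine lt_of_le_of_ne ?_ ?_
  · rcases h with ⟨h1, h2, h3⟩ | ⟨h1, h2⟩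
    · exact Or.inr ⟨h1, by rw [h3]; exact (PNat.lt_add_right _ _).le⟩
    · exact Or.inl ⟨h1.symm, by rw [h2]; exact (PNat.lt_add_right _ _).le⟩
  · rintro rfl
    rcases h with ⟨h1, h2, h3⟩ | ⟨h1, h2⟩
    · exact absurd h3 (PNat.lt_add_right _ _).ne
    · exact absurd h2 (PNat.lt_add_right _ _).ne

theorem le_iff_reflTransGen (p q : PosPair) : p ≤ q ↔ Relation.ReflTransGen Step p q := by
  constructor
  · have row : ∀ (y a b : ℕ+), a ≤ b → Relation.ReflTransGen Step ⟨a, y⟩ ⟨b, y⟩ := by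
      intro y a b
      induction b using PNat.recOn with
      | one => intro h; rw [le_antisymm h (one_le)]
      | succ b ih =>
        intro h
        rcases h.lt_or_eq with h | rfl
        · exact (ih (PNat.lt_add_one_iff.1 h)).tail (Or.inr ⟨rfl, rfl⟩)
        · exact .refl
    have col : ∀ (a b : ℕ+), a ≤ b → Relation.ReflTransGen Step ⟨1, a⟩ ⟨1, b⟩ := by
      intro a b
      induction b using PNat.recOn with
      | one => intro h; rw [le_antisymm h (one_le)]
      | succ b ih =>
        intro h
        rcases h.lt_or_eq with h | rfl
        · exact (ih (PNat.lt_add_one_iff.1 h)).tail (Or.inl ⟨rfl, rfl, rfl⟩)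
        · exact .refl
    obtain ⟨a, b⟩ := p
    obtain ⟨c, d⟩ := q
    rintro (⟨h1, h2⟩ | ⟨h1, h2⟩)
    · obtain rfl : b = d := h1
      exact row _ _ _ h2
    · obtain rfl : a = 1 := h1
      exact (col _ _ h2).trans (row _ _ _ (one_le))
  · intro h
    induction h with
    | refl => exact le_refl _
    | tail _ h ih => exact ih.trans h.lt.le

theorem covBy_iff (p q : PosPair) : p ⋖ q ↔ Step p q := by
  constructor
  · intro h
    rcases Relation.ReflTransGen.cases_head ((le_iff_reflTransGen p q).1 h.1.le) with
      e | ⟨r, h1, h2⟩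
    · exact absurd e h.1.ne
    · rcases ((le_iff_reflTransGen r q).2 h2).lt_or_eq with h3 | rfl
      · exact absurd h3 (h.2 h1.lt)
      · exact h1
  · intro h
    refine ⟨h.lt, fun r h1 h2 => ?_⟩
    have e1 := h1.ne
    have e2 := h2.ne
    have l1 := (le_def _ _).1 h1.le
    have l2 := (le_def _ _).1 h2.le
    obtain ⟨a, b⟩ := p
    obtain ⟨c, d⟩ := q
    obtain ⟨u, v⟩ := r
    simp only [Step, ne_eq, PosPair.mk.injEq, ← PNat.coe_inj, ← PNat.coe_le_coe, PNat.add_coe,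
      PNat.one_coe] at *
    have := a.pos
    have := u.pos
    have := c.pos
    omega

end PosPair

/-- An ideal: a finite lower ideal of the poset of pairs of positive integers. -/
def IsIdeal (I : Set PosPair) : Prop :=
  I.Finite ∧ IsLowerSet I

/-- `f` is an `A`-labelling of `E`: a bijective increasing map from `E` (with the induced order)
to `A`. Maps defined on `E` are encoded as functions to `Option A` that take the value `none`
exactly outside `E`. -/
structure IsLabelling {A : Type*} [LinearOrder A] (E : Set PosPair) (f : PosPair → Option A) :
    Prop where
  domain : ∀ p, p ∈ E ↔ f p ≠ none
  bijective : ∀ a, ∃! p, f p = some a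
  increasing : ∀ p q a b, p ≤ q → f p = some a → f q = some b → a ≤ b

/-- A skew partition: an `A`-labelling of the skew ideal `outer \ inner`. -/
@[ext]
structure SkewPartition (A : Type*) [LinearOrder A] where
  outer : Set PosPair
  inner : Set PosPair
  isIdeal_outer : IsIdeal outer
  isIdeal_inner : IsIdeal inner
  inner_subset : inner ⊆ outer
  label : PosPair → Option A
  isLabelling : IsLabelling (outer \ inner) label

/-- A skew partition with a hole: a skew ideal `outer \ inner`, a point `hole` in it, and an
`A`-labelling of the other points of the skew ideal. -/
@[ext]
structure HoledSkewPartition (A : Type*) [LinearOrder A] where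
  outer : Set PosPair
  inner : Set PosPair
  isIdeal_outer : IsIdeal outer
  isIdeal_inner : IsIdeal inner
  inner_subset : inner ⊆ outer
  hole : PosPair
  hole_mem : hole ∈ outer \ inner
  label : PosPair → Option A
  isLabelling : IsLabelling ((outer \ inner) \ {hole}) label

namespace HoledSkewPartition

variable {A : Type*} [LinearOrder A]

/-- The hole is an upper corner of the shape. -/
def IsUpper (Q : HoledSkewPartition A) : Prop :=
  IsIdeal (Q.outer \ {Q.hole})

/-- The downward move when the hole is not upper: among the points of the shape that cover the
hole (one or two), the one with the smallest label becomes the new hole, and its label goes to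
the old hole. -/
def Move (Q Q' : HoledSkewPartition A) : Prop :=
  ¬ Q.IsUpper ∧ Q'.outer = Q.outer ∧ Q'.inner = Q.inner ∧
    Q.hole ⋖ Q'.hole ∧
    (∃ a, Q.label Q'.hole = some a ∧
      ∀ L ∈ Q.outer \ Q.inner, Q.hole ⋖ L → ∀ b, Q.label L = some b → a ≤ b) ∧
    Q'.label = Function.update (Function.update Q.label Q.hole (Q.label Q'.hole)) Q'.hole none

/-- The downward move when the hole is upper: the hole is removed from the shape. -/
def Remove (Q : HoledSkewPartition A) (R : SkewPartition A) : Prop :=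
  Q.IsUpper ∧ R.outer = Q.outer \ {Q.hole} ∧ R.inner = Q.inner ∧ R.label = Q.label

end HoledSkewPartition

namespace SkewPartition

variable {A : Type*} [LinearOrder A]

/-- A skew partition is a partition if the removed ideal is empty, i.e. if it is an
`A`-labelling of an ideal. -/
def IsPartition (R : SkewPartition A) : Prop :=
  R.inner = ∅

/-- `Q` is `R` together with the hole `H`, where `H` is a maximal element of the inner ideal. -/
def OpenHole (R : SkewPartition A) (H : PosPair) (Q : HoledSkewPartition A) : Prop :=
  Maximal (· ∈ R.inner) H ∧ Q.outer = R.outer ∧ Q.inner = R.inner \ {H} ∧ Q.hole = H ∧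
    Q.label = R.label

/-- The downward slide of `R` starting at the maximal element `H` of the inner ideal produces
`R'`: one opens a hole at `H` and iterates downward moves until the hole is removed. -/
def SlideAt (H : PosPair) (R R' : SkewPartition A) : Prop :=
  ∃ Q Q' : HoledSkewPartition A, R.OpenHole H Q ∧
    Relation.ReflTransGen HoledSkewPartition.Move Q Q' ∧ Q'.Remove R'

/-- One downward slide, for some choice of the starting point. -/
def Slide (R R' : SkewPartition A) : Prop :=
  ∃ H, SlideAt H R R'

/-- `R'` is obtained from `R` by a finite sequence of downward slides. -/
def Reaches (R R' : SkewPartition A) : Prop :=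
  Relation.ReflTransGen Slide R R'

end SkewPartition

/-! ### Row insertion: the invariant of the slides -/

section RowInsertion

variable {A : Type*} [LinearOrder A]

/-! Confluence comes from an invariant that depends only on the sets of labels of the rows. A
horizontal move keeps every label in its row. A vertical move starts from a hole `(1, y)`, which
lies below every point of the rows from `y` on; hence the inner ideal misses these rows, the rows
above `y` have increasing minima, and the move carries the smallest label of row `y + 1` into row
`y`, whose labels are all larger. Row insertion performs exactly this transfer, so `rectifyRows` of
the row contents is the same before and after (`rectifyRows_transfer`, `Move.rectifyRows_eq`).

In a partition the row minima increase, and `rectifyRows` returns the rows themselves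
(`rectifyRows_of_min_le`); these determine the partition because each row is filled from the first
column on in increasing order (`eq_of_rowLabels_eq`). The final partition can thus be read off the
initial labels alone.

Termination is by counting: a move lowers the number of points above the hole, a slide lowers the
size of the inner ideal. -/

/-- Insertion of a row `l` below a list of rows: as long as the smallest element of the next row
is smaller than all elements of the current row, it goes down to the current row. -/
def insertRow : Finset A → List (Finset A) → List (Finset A)
  | l, [] => [l]
  | l, k :: K =>
    if k.min < l.min then
      (l ∪ k.filter fun a => (a : WithTop A) = k.min) ::
        insertRow (k.filter fun a => (a : WithTop A) ≠ k.min) K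
    else l :: k :: K

/-- Successive insertion of the rows `S (n - 1)`, …, `S 0`. -/
def rectifyRows : ℕ → (ℕ → Finset A) → List (Finset A)
  | 0, _ => []
  | n + 1, S => insertRow (S 0) (rectifyRows n fun i => S (i + 1))

theorem insertRow_eq_cons {l : Finset A} {K : List (Finset A)}
    (h : ∀ k ∈ K.head?, l.min ≤ k.min) : insertRow l K = l :: K := by
  cases K with
  | nil => rfl
  | cons k K => simp [insertRow, h k (by simp)]

theorem le_min_of_mem_head?_insertRow {m : WithTop A} {l : Finset A} {K : List (Finset A)}
    (hl : m ≤ l.min) (hK : ∀ k ∈ K.head?, m ≤ k.min) :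
    ∀ k ∈ (insertRow l K).head?, m ≤ k.min := by
  cases K with
  | nil => simpa [insertRow] using hl
  | cons k K =>
    have hk : m ≤ k.min := hK k (by simp)
    unfold insertRow
    split_ifs
    · intro k' hk'
      obtain rfl : _ = k' := by simpa using hk'
      refine Finset.le_min fun a ha => ?_
      rcases Finset.mem_union.1 ha with ha | ha
      · exact hl.trans (Finset.min_le ha)
      · exact hk.trans (Finset.min_le (Finset.mem_filter.1 ha).1)
    · simpa using hl

theorem head?_ofFn_min {S : ℕ → Finset A} {m : WithTop A} (h : m ≤ (S 0).min) (n : ℕ) :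
    ∀ k ∈ (List.ofFn fun i : Fin n => S i).head?, m ≤ k.min := by
  cases n with
  | zero => simp
  | succ n => simpa [List.ofFn_succ] using h

/-- No insertion displaces anything when the minima are sorted. An empty row has minimum `⊤`, so the
hypothesis allows only empty rows after an empty one. -/
theorem rectifyRows_of_min_le {S : ℕ → Finset A} (h : ∀ i, (S i).min ≤ (S (i + 1)).min) (n : ℕ) :
    rectifyRows n S = List.ofFn fun i : Fin n => S i := by
  induction n generalizing S with
  | zero => simp [rectifyRows]
  | succ n ih =>
    rw [rectifyRows, ih fun i => h (i + 1), insertRow_eq_cons, List.ofFn_succ]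
    · rfl
    · exact head?_ofFn_min (S := fun i => S (i + 1)) (h 0) n

/-- The rows from `j + 1` on are sorted, hence already rectified, so inserting `S j` begins by
bringing down the minimum of `S (j + 1)` and then inserts the rest of that row. If the transfer has
been made beforehand, the same rest is inserted first, and `S' j` then displaces nothing. -/
theorem rectifyRows_transfer {S S' : ℕ → Finset A} {j n : ℕ} (hj : j + 1 < n)
    (hS : ∀ i, j < i → (S i).min ≤ (S (i + 1)).min) (hlt : (S (j + 1)).min < (S j).min)
    (h₀ : S' j = S j ∪ (S (j + 1)).filter fun a => (a : WithTop A) = (S (j + 1)).min)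
    (h₁ : S' (j + 1) = (S (j + 1)).filter fun a : A => (a : WithTop A) ≠ (S (j + 1)).min)
    (h : ∀ i, i ≠ j → i ≠ j + 1 → S' i = S i) :
    rectifyRows n S' = rectifyRows n S := by
  induction j generalizing n S S' with
  | zero =>
    obtain ⟨n, rfl⟩ : ∃ m, n = m + 2 := ⟨n - 2, by omega⟩
    have htail : (fun i => S' (i + 1 + 1)) = fun i => S (i + 1 + 1) :=
      funext fun i => h _ (by omega) (by omega)
    have hK := rectifyRows_of_min_le (S := fun i => S (i + 1 + 1))
      (fun i => hS (i + 1 + 1) (by omega)) n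
    have hhead := head?_ofFn_min (S := fun i => S (i + 1 + 1)) (hS 1 (by omega)) n
    simp only [rectifyRows, htail, hK, zero_add] at *
    rw [insertRow_eq_cons hhead, h₁, insertRow_eq_cons, insertRow, if_pos hlt, h₀]
    -- The transferred minimum now lies in `S' 0` and bounds from below everything in the rows
    -- above.
    have hc : (S' 0).min ≤ (S 1).min := by
      obtain ⟨c, hc⟩ := WithTop.ne_top_iff_exists.1 (ne_top_of_lt hlt)
      rw [← hc]
      refine Finset.min_le ?_
      rw [h₀]
      exact Finset.mem_union_right _ (Finset.mem_filter.2 ⟨Finset.mem_of_min hc.symm, hc⟩)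
    exact le_min_of_mem_head?_insertRow
      (Finset.le_min fun a ha => hc.trans (Finset.min_le (Finset.mem_filter.1 ha).1))
      fun k hk => hc.trans (hhead k hk)
  | succ j ih =>
    obtain ⟨n, rfl⟩ : ∃ m, n = m + 1 := ⟨n - 1, by omega⟩
    rw [rectifyRows, rectifyRows, h 0 (by omega) (by omega)]
    congr 1
    exact ih (by omega) (fun i hi => hS (i + 1) (by omega)) hlt h₀ h₁
      fun i h1 h2 => h (i + 1) (by omega) (by omega)

end RowInsertion

/-! ### Covers and comparisons in the poset -/

namespace PosPair

theorem exists_covBy_le {p q : PosPair} (h : p < q) : ∃ r, p ⋖ r ∧ r ≤ q := by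
  rcases Relation.ReflTransGen.cases_head ((le_iff_reflTransGen p q).1 h.le) with e | ⟨r, h1, h2⟩
  · exact absurd e h.ne
  · exact ⟨r, (covBy_iff p r).2 h1, (le_iff_reflTransGen r q).2 h2⟩

theorem mk_le_mk_right {x x' y : ℕ+} (h : x ≤ x') : (⟨x, y⟩ : PosPair) ≤ ⟨x', y⟩ :=
  Or.inl ⟨rfl, h⟩

theorem one_mk_le {x y y' : ℕ+} (h : y ≤ y') : (⟨1, y⟩ : PosPair) ≤ ⟨x, y'⟩ :=
  Or.inr ⟨rfl, h⟩

end PosPair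

/-! ### Row contents of a labelling -/

section RowLabels

variable {A : Type*} [LinearOrder A]

theorem IsLabelling.injective {E : Set PosPair} {f : PosPair → Option A} (hf : IsLabelling E f)
    {p q : PosPair} {a : A} (hp : f p = some a) (hq : f q = some a) : p = q :=
  (hf.bijective a).unique hp hq

theorem IsLabelling.exists_eq_some {E : Set PosPair} {f : PosPair → Option A}
    (hf : IsLabelling E f) {p : PosPair} (hp : p ∈ E) : ∃ a, f p = some a :=
  Option.ne_none_iff_exists'.1 ((hf.domain p).1 hp)

theorem IsLabelling.mem {E : Set PosPair} {f : PosPair → Option A}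
    (hf : IsLabelling E f) {p : PosPair} {a : A} (hp : f p = some a) : p ∈ E :=
  (hf.domain p).2 (by simp [hp])

open Classical in
/-- The set of labels in the row `y = i + 1`. -/
noncomputable def rowLabels {A : Type*} [Fintype A] (f : PosPair → Option A) (i : ℕ) : Finset A :=
  Finset.univ.filter fun a => ∃ x, f ⟨x, i.succPNat⟩ = some a

theorem mem_rowLabels {A : Type*} [Fintype A] {f : PosPair → Option A} {i : ℕ} {a : A} :
    a ∈ rowLabels f i ↔ ∃ x, f ⟨x, i.succPNat⟩ = some a := by
  simp [rowLabels]

variable [Fintype A]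

/-- Both labellings agree to the left of `x`, so `a` sits in `g` at column `x` or later. As `E'` is
a lower set, `g` has a label `b ≤ a` at `x`; likewise `b` sits in `f` at column `x` or later, which
gives `a ≤ b`. -/
theorem eq_some_of_rowLabels_eq {E E' : Set PosPair} {f g : PosPair → Option A}
    (hE' : IsLowerSet E') (hf : IsLabelling E f) (hg : IsLabelling E' g)
    (h : ∀ i, rowLabels f i = rowLabels g i) (x y : ℕ+)
    (ih : ∀ x' < x, f ⟨x', y⟩ = g ⟨x', y⟩) {a : A} (ha : f ⟨x, y⟩ = some a) :
    g ⟨x, y⟩ = some a := by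
  have hrow : ∀ b, (∃ x, f ⟨x, y⟩ = some b) ↔ ∃ x, g ⟨x, y⟩ = some b := by
    intro b
    have := Finset.ext_iff.1 (h y.natPred) b
    rwa [mem_rowLabels, mem_rowLabels, PNat.succPNat_natPred] at this
  obtain ⟨x₁, h₁⟩ := (hrow a).1 ⟨x, ha⟩
  have hx₁ : x ≤ x₁ := by
    by_contra! hlt
    have := hf.injective ha ((ih x₁ hlt).trans h₁)
    simp only [PosPair.mk.injEq, and_true] at this
    exact hlt.ne this.symm
  obtain ⟨b, hb⟩ := hg.exists_eq_some (hE' (PosPair.mk_le_mk_right hx₁) (hg.mem h₁))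
  have hba := hg.increasing _ _ _ _ (PosPair.mk_le_mk_right hx₁) hb h₁
  obtain ⟨x₂, h₂⟩ := (hrow b).2 ⟨x, hb⟩
  have hx₂ : x ≤ x₂ := by
    by_contra! hlt
    have := hg.injective hb ((ih x₂ hlt).symm.trans h₂)
    simp only [PosPair.mk.injEq, and_true] at this
    exact hlt.ne this.symm
  have hab := hf.increasing _ _ _ _ (PosPair.mk_le_mk_right hx₂) ha h₂
  rw [hb, le_antisymm hab hba]

theorem eq_of_rowLabels_eq {E E' : Set PosPair} {f g : PosPair → Option A}
    (hE : IsLowerSet E) (hE' : IsLowerSet E') (hf : IsLabelling E f) (hg : IsLabelling E' g)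
    (h : ∀ i, rowLabels f i = rowLabels g i) : f = g := by
  funext ⟨x, y⟩
  induction x using PNat.strongInductionOn with
  | _ x ih =>
    ext a
    exact ⟨eq_some_of_rowLabels_eq hE' hf hg h x y ih,
      eq_some_of_rowLabels_eq hE hg hf (fun i => (h i).symm) x y fun x' hx' => (ih x' hx').symm⟩

/-- In a skew ideal that contains all points of the rows above a given one, the smallest labels of
these rows increase. -/
theorem rowLabels_min_le {O I : Set PosPair} {f : PosPair → Option A} {j : ℕ} {h : Set PosPair}
    (hO : IsLowerSet O) (hf : IsLabelling ((O \ I) \ h) f)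
    (hj : ∀ i, j ≤ i → (⟨1, i.succPNat⟩ : PosPair) ∉ I ∧ (⟨1, i.succPNat⟩ : PosPair) ∉ h)
    {i : ℕ} (hi : j ≤ i) : (rowLabels f i).min ≤ (rowLabels f (i + 1)).min := by
  refine Finset.le_min fun b hb => ?_
  obtain ⟨x, hx⟩ := mem_rowLabels.1 hb
  have hle : (⟨1, i.succPNat⟩ : PosPair) ≤ ⟨x, (i + 1).succPNat⟩ :=
    PosPair.one_mk_le (Nat.succPNat_le_succPNat.2 i.le_succ)
  obtain ⟨a, ha⟩ := hf.exists_eq_some (p := ⟨1, i.succPNat⟩)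
    ⟨⟨hO hle (hf.mem hx).1.1, (hj i hi).1⟩, (hj i hi).2⟩
  exact (Finset.min_le (mem_rowLabels.2 ⟨1, ha⟩)).trans
    (WithTop.coe_le_coe.2 (hf.increasing _ _ _ _ hle ha hx))

end RowLabels

/-! ### Moves of the hole -/

namespace HoledSkewPartition

variable {A : Type*} [LinearOrder A]

theorem mem_of_hole_lt {Q : HoledSkewPartition A} {p : PosPair} (hp : p ∈ Q.outer)
    (h : Q.hole < p) : p ∈ (Q.outer \ Q.inner) \ {Q.hole} :=
  ⟨⟨hp, fun hi => Q.hole_mem.2 (Q.isIdeal_inner.2 h.le hi)⟩, h.ne'⟩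

theorem label_hole (Q : HoledSkewPartition A) : Q.label Q.hole = none := by
  by_contra h
  exact ((Q.isLabelling.domain _).2 h).2 rfl

theorem exists_hole_lt {Q : HoledSkewPartition A} (h : ¬ Q.IsUpper) :
    ∃ p ∈ Q.outer, Q.hole < p := by
  by_contra! hn
  refine h ⟨Q.isIdeal_outer.1.subset Set.sdiff_subset, fun q p hpq hq => ?_⟩
  refine ⟨Q.isIdeal_outer.2 hpq hq.1, ?_⟩
  rintro rfl
  exact hn q hq.1 (lt_of_le_of_ne hpq (Ne.symm hq.2))

theorem exists_move {Q : HoledSkewPartition A} (h : ¬ Q.IsUpper) : ∃ Q', Q.Move Q' := by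
  obtain ⟨p, hp, hlt⟩ := exists_hole_lt h
  obtain ⟨L₀, hL₀, hL₀p⟩ := PosPair.exists_covBy_le hlt
  -- The default `⊤` is never used: every point of the outer ideal above the hole is labelled.
  obtain ⟨K, ⟨hKO, hK⟩, hmin⟩ := Set.exists_min_image {L | L ∈ Q.outer ∧ Q.hole ⋖ L}
    (fun L => (Q.label L).elim (⊤ : WithTop A) (↑))
    (Q.isIdeal_outer.1.subset fun _ h => h.1) ⟨L₀, Q.isIdeal_outer.2 hL₀p hp, hL₀⟩
  obtain ⟨a, ha⟩ := Q.isLabelling.exists_eq_some (mem_of_hole_lt hKO hK.lt)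
  have hKh : K ≠ Q.hole := hK.lt.ne'
  have hKmin : ∀ L ∈ Q.outer, Q.hole ⋖ L → ∀ b, Q.label L = some b → a ≤ b := by
    intro L hL hLc b hb
    have := hmin L ⟨hL, hLc⟩
    simpa [ha, hb] using this
  have hlab : ∀ q, Function.update (Function.update Q.label Q.hole (Q.label K)) K none q =
      if q = K then none else if q = Q.hole then some a else Q.label q := by
    intro q
    simp only [Function.update_apply, ha]
  refine ⟨⟨Q.outer, Q.inner, Q.isIdeal_outer, Q.isIdeal_inner, Q.inner_subset, K,
    (mem_of_hole_lt hKO hK.lt).1,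
    Function.update (Function.update Q.label Q.hole (Q.label K)) K none, ?_, ?_, ?_⟩,
    h, rfl, rfl, hK, ⟨a, ha, fun L hL => hKmin L hL.1⟩, rfl⟩
  · intro q
    rw [hlab]
    split_ifs with h1 h2
    · simp [h1]
    · simp [h2, hKh.symm, Q.hole_mem.1, Q.hole_mem.2]
    · rw [← Q.isLabelling.domain]
      simp [h1, h2]
  · intro c
    simp only [hlab]
    by_cases hc : c = a
    · subst hc
      refine ⟨Q.hole, by simp [hKh.symm], fun q hq => ?_⟩
      by_contra hne
      by_cases hqK : q = K
      · simp [hqK] at hq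
      · simp only [hqK, hne, if_false] at hq
        exact hqK (Q.isLabelling.injective hq ha)
    · obtain ⟨q, hq, huniq⟩ := Q.isLabelling.bijective c
      have h1 : q ≠ K := by rintro rfl; exact hc (by simpa [ha] using hq.symm)
      have h2 : q ≠ Q.hole := by rintro rfl; simp [label_hole] at hq
      refine ⟨q, by simpa [h1, h2] using hq, fun r hr => ?_⟩
      simp only at hr
      split_ifs at hr with h3 h4
      · exact absurd (Option.some.inj hr).symm hc
      · exact huniq r hr
  · intro q r b c hqr hb hc
    rw [hlab] at hb hc
    split_ifs at hb hc with h1 h2 h3 h4 h5 h6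
    · exact (Option.some.inj (hb.symm.trans hc)).le
    -- The label `a` in the old hole stays below the labels above it, since any such point lies over
    -- a cover of the hole and `a` is the least label of a cover.
    · obtain rfl := Option.some.inj hb
      subst h2
      obtain ⟨L, hL, hLr⟩ := PosPair.exists_covBy_le (lt_of_le_of_ne hqr (Ne.symm h4))
      have hLO : L ∈ Q.outer := Q.isIdeal_outer.2 hLr (Q.isLabelling.mem hc).1.1
      obtain ⟨d, hd⟩ := Q.isLabelling.exists_eq_some (mem_of_hole_lt hLO hL.lt)
      exact (hKmin L hLO hL d hd).trans (Q.isLabelling.increasing _ _ _ _ hLr hd hc)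
    · obtain rfl := Option.some.inj hc
      subst h6
      exact Q.isLabelling.increasing _ _ _ _ (hqr.trans hK.le) hb ha
    · exact Q.isLabelling.increasing _ _ _ _ hqr hb hc

theorem Move.rightUnique : Relator.RightUnique (Move (A := A)) := by
  rintro Q Q₁ Q₂ ⟨-, ho, hi, hc, ⟨a, ha, hmin⟩, hl⟩ ⟨-, ho', hi', hc', ⟨b, hb, hmin'⟩, hl'⟩
  have hab : a = b := le_antisymm (hmin _ (Q.isLabelling.mem hb).1 hc' b hb)
    (hmin' _ (Q.isLabelling.mem ha).1 hc a ha)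
  subst hab
  have hh := Q.isLabelling.injective ha hb
  ext1
  · rw [ho, ho']
  · rw [hi, hi']
  · exact hh
  · rw [hl, hl', hh]

theorem exists_isUpper (Q : HoledSkewPartition A) :
    ∃ Q', Relation.ReflTransGen Move Q Q' ∧ Q'.IsUpper := by
  -- The shape is fixed while the hole rises strictly, so fewer points remain above it.
  induction hn : (Q.outer ∩ Set.Ioi Q.hole).ncard using Nat.strong_induction_on generalizing Q with
  | _ n ih =>
    by_cases h : Q.IsUpper
    · exact ⟨Q, .refl, h⟩
    obtain ⟨Q₁, h₁⟩ := exists_move h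
    obtain ⟨-, ho, -, hc, ⟨a, ha, -⟩, -⟩ := id h₁
    obtain ⟨Q', h', hu⟩ := ih _ (by
      rw [← hn]
      refine Set.ncard_lt_ncard ⟨?_, fun hsub => ?_⟩ (Q.isIdeal_outer.1.subset Set.inter_subset_left)
      · rw [ho]
        exact fun p hp => ⟨hp.1, hc.lt.trans hp.2⟩
      · exact lt_irrefl Q₁.hole (hsub ⟨(Q.isLabelling.mem ha).1.1, hc.lt⟩).2) Q₁ rfl
    exact ⟨Q', h'.head h₁, hu⟩

theorem eq_of_isUpper {Q Q₁ Q₂ : HoledSkewPartition A} (h₁ : Relation.ReflTransGen Move Q Q₁)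
    (h₂ : Relation.ReflTransGen Move Q Q₂) (hu₁ : Q₁.IsUpper) (hu₂ : Q₂.IsUpper) : Q₁ = Q₂ := by
  have key : ∀ {P P' : HoledSkewPartition A}, Relation.ReflTransGen Move P P' → P.IsUpper →
      P = P' := by
    intro P P' h hP
    rcases h.cases_head with h | ⟨_, h, -⟩
    · exact h
    · exact absurd hP h.1
  rcases Relation.ReflTransGen.total_of_right_unique Move.rightUnique h₁ h₂ with h | h
  · exact key h hu₁
  · exact (key h hu₂).symm

theorem existsUnique_remove {Q : HoledSkewPartition A} (h : Q.IsUpper) : ∃! R, Q.Remove R := by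
  refine ⟨⟨Q.outer \ {Q.hole}, Q.inner, h, Q.isIdeal_inner, fun p hp => ⟨Q.inner_subset hp, ?_⟩,
    Q.label, ?_⟩, ⟨h, rfl, rfl, rfl⟩, ?_⟩
  · rintro rfl
    exact Q.hole_mem.2 hp
  · rw [Set.sdiff_sdiff_comm]
    exact Q.isLabelling
  · rintro R ⟨-, ho, hi, hl⟩
    exact SkewPartition.ext ho hi hl

theorem outer_inner_eq_of_moves {Q Q' : HoledSkewPartition A}
    (h : Relation.ReflTransGen Move Q Q') : Q'.outer = Q.outer ∧ Q'.inner = Q.inner := by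
  induction h with
  | refl => exact ⟨rfl, rfl⟩
  | tail _ h ih => exact ⟨h.2.1.trans ih.1, h.2.2.1.trans ih.2⟩

theorem Move.rectifyRows_eq [Fintype A] {Q Q' : HoledSkewPartition A} (h : Q.Move Q') {n : ℕ}
    (hn : ∀ p ∈ Q.outer, (p.y : ℕ) ≤ n) :
    rectifyRows n (rowLabels Q'.label) = rectifyRows n (rowLabels Q.label) := by
  obtain ⟨-, -, -, hc, ⟨c, hcK, hmin⟩, hl⟩ := h
  have hlab : ∀ q, Q'.label q =
      if q = Q'.hole then none else if q = Q.hole then some c else Q.label q := by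
    intro q
    simp only [hl, Function.update_apply, hcK]
  have hne := hc.lt.ne
  -- In terms of rows, the move only relocates `c` to the row of the old hole.
  have hmem : ∀ i a, a ∈ rowLabels Q'.label i ↔
      (a = c ∧ Q.hole.y = i.succPNat) ∨ (a ≠ c ∧ a ∈ rowLabels Q.label i) := by
    intro i a
    simp only [mem_rowLabels, hlab]
    constructor
    · rintro ⟨x, hx⟩
      split_ifs at hx with h1 h2
      · exact Or.inl ⟨(Option.some.inj hx).symm, by rw [← h2]⟩
      · refine Or.inr ⟨?_, x, hx⟩
        rintro rfl
        exact h1 (Q.isLabelling.injective hx hcK)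
    · rintro (⟨rfl, hy⟩ | ⟨hac, x, hx⟩)
      · refine ⟨Q.hole.x, ?_⟩
        rw [← hy]
        simp [hne]
      · refine ⟨x, ?_⟩
        rw [if_neg, if_neg, hx]
        · intro e
          rw [e, label_hole] at hx
          simp at hx
        · intro e
          rw [e, hcK] at hx
          exact hac (Option.some.inj hx).symm
  have hrow : ∀ i, c ∈ rowLabels Q.label i ↔ Q'.hole.y = i.succPNat := by
    intro i
    rw [mem_rowLabels]
    constructor
    · rintro ⟨x, hx⟩
      rw [Q.isLabelling.injective hcK hx]
    · intro hy
      exact ⟨Q'.hole.x, by rw [← hy]; exact hcK⟩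
  rcases (PosPair.covBy_iff _ _).1 hc with ⟨hx, hx', hy⟩ | ⟨hy, -⟩
  · obtain ⟨j, hj⟩ : ∃ j : ℕ, Q.hole.y = j.succPNat := ⟨_, (PNat.succPNat_natPred _).symm⟩
    have hj' : Q'.hole.y = (j + 1).succPNat := by
      rw [hy, hj]
      rfl
    have hhole : Q.hole = ⟨1, j.succPNat⟩ := PosPair.ext hx hj
    have hhole' : Q'.hole = ⟨1, (j + 1).succPNat⟩ := PosPair.ext hx' hj'
    have hnot : ∀ (i : ℕ), j ≤ i → ∀ x, (⟨x, i.succPNat⟩ : PosPair) ∉ Q.inner := fun i hi x hm =>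
      Q.hole_mem.2 (Q.isIdeal_inner.2
        (hhole ▸ PosPair.one_mk_le (Nat.succPNat_le_succPNat.2 hi)) hm)
    have hcmin : (rowLabels Q.label (j + 1)).min = c := by
      refine le_antisymm (Finset.min_le ((hrow _).2 hj')) (Finset.le_min fun b hb => ?_)
      obtain ⟨x, hb⟩ := mem_rowLabels.1 hb
      exact WithTop.coe_le_coe.2 (Q.isLabelling.increasing _ _ _ _
        (hhole' ▸ PosPair.one_mk_le le_rfl) hcK hb)
    refine rectifyRows_transfer (j := j) ?_ ?_ ?_ ?_ ?_ ?_
    · have := hn _ (Q.isLabelling.mem hcK).1.1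
      rw [hj'] at this
      simpa using this
    · intro i hi
      refine rowLabels_min_le (j := j + 1) Q.isIdeal_outer.2 Q.isLabelling
        (fun i hi => ⟨hnot i (by omega) 1, ?_⟩) hi
      rw [Set.mem_singleton_iff, hhole]
      intro e
      have := Nat.succPNat_injective (PosPair.mk.inj e).2
      omega
    · rw [hcmin]
      -- The hole may be alone in its row. Otherwise every label of that row lies over a cover of
      -- the hole, so it is at least `c`, and it differs from `c`, which is in the next row.
      obtain hbot | ⟨b, hb⟩ := (rowLabels Q.label j).eq_empty_or_nonempty
      · rw [hbot, Finset.min_empty]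
        exact WithTop.coe_lt_top c
      obtain ⟨b, hbm⟩ := Finset.min_of_mem hb
      rw [hbm, WithTop.coe_lt_coe]
      have hb := Finset.mem_of_min hbm
      obtain ⟨x, hx⟩ := mem_rowLabels.1 hb
      have hlt : Q.hole < ⟨x, j.succPNat⟩ := lt_of_le_of_ne
        (hhole ▸ PosPair.one_mk_le le_rfl) (Ne.symm (Q.isLabelling.mem hx).2)
      obtain ⟨L, hL, hLx⟩ := PosPair.exists_covBy_le hlt
      have hLm := mem_of_hole_lt (Q.isIdeal_outer.2 hLx (Q.isLabelling.mem hx).1.1) hL.lt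
      obtain ⟨d, hd⟩ := Q.isLabelling.exists_eq_some hLm
      refine lt_of_le_of_ne ((hmin L hLm.1 hL d hd).trans
        (Q.isLabelling.increasing _ _ _ _ hLx hd hx)) ?_
      rintro rfl
      have := Nat.succPNat_injective (hj'.symm.trans ((hrow j).1 hb))
      omega
    · ext a
      have hcj : c ∉ rowLabels Q.label j := by
        rw [hrow, hj']
        intro e
        have := Nat.succPNat_injective e
        omega
      simp only [hmem, hj, hcmin, Finset.mem_union, Finset.mem_filter, WithTop.coe_inj]
      have := (hrow (j + 1)).2 hj'
      by_cases e : a = c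
      · subst e
        simp [this]
      · simp [e]
    · ext a
      have : Q.hole.y ≠ (j + 1).succPNat := by
        rw [hj]
        intro e
        have := Nat.succPNat_injective e
        omega
      simp only [hmem, hcmin, Finset.mem_filter, ne_eq, WithTop.coe_inj, this]
      tauto
    · intro i h1 h2
      ext a
      have e1 : Q.hole.y ≠ i.succPNat := by
        rw [hj]
        exact fun e => h1 (Nat.succPNat_injective e).symm
      have e2 : c ∉ rowLabels Q.label i := by
        rw [hrow, hj']
        exact fun e => h2 (Nat.succPNat_injective e).symm
      rw [hmem]
      by_cases e : a = c
      · subst e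
        simp [e1, e2]
      · simp [e]
  · congr 1
    funext i
    ext a
    rw [hmem, ← hy, ← hrow]
    by_cases e : a = c
    · subst e
      simp
    · simp [e]

end HoledSkewPartition

/-! ### Slides, termination and uniqueness -/

namespace SkewPartition

variable {A : Type*} [LinearOrder A]

theorem existsUnique_openHole {R : SkewPartition A} {H : PosPair} (hH : Maximal (· ∈ R.inner) H) :
    ∃! Q, R.OpenHole H Q := by
  have hset : (R.outer \ (R.inner \ {H})) \ {H} = R.outer \ R.inner := by
    ext p
    have := hH.1
    by_cases e : p = H
    · subst e
      simpa using fun _ => this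
    · simp [e]
  refine ⟨⟨R.outer, R.inner \ {H}, R.isIdeal_outer,
    ⟨R.isIdeal_inner.1.subset Set.sdiff_subset, fun q p hpq hq =>
      ⟨R.isIdeal_inner.2 hpq hq.1, ?_⟩⟩, Set.sdiff_subset.trans R.inner_subset, H,
    ⟨R.inner_subset hH.1, fun h => h.2 rfl⟩, R.label, ?_⟩, ⟨hH, rfl, rfl, rfl, rfl⟩, ?_⟩
  · rintro rfl
    exact hq.2 (le_antisymm (hH.2 hq.1 hpq) hpq)
  · rw [hset]
    exact R.isLabelling
  · rintro Q ⟨-, ho, hi, hh, hl⟩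
    exact HoledSkewPartition.ext ho hi hh hl

theorem existsUnique_slideAt {R : SkewPartition A} {H : PosPair} (hH : Maximal (· ∈ R.inner) H) :
    ∃! R', SlideAt H R R' := by
  obtain ⟨Q, hQ, hQu⟩ := existsUnique_openHole hH
  obtain ⟨Q', hm, hu⟩ := Q.exists_isUpper
  obtain ⟨R', hR', hRu⟩ := HoledSkewPartition.existsUnique_remove hu
  refine ⟨R', ⟨Q, Q', hQ, hm, hR'⟩, ?_⟩
  rintro R₁ ⟨Q₁, Q₁', hQ₁, hm₁, hR₁⟩
  obtain rfl := hQu Q₁ hQ₁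
  obtain rfl := HoledSkewPartition.eq_of_isUpper hm hm₁ hu hR₁.1
  exact hRu R₁ hR₁

theorem isPartition_or_exists_maximal (R : SkewPartition A) :
    R.IsPartition ∨ ∃ H, Maximal (· ∈ R.inner) H := by
  rcases R.inner.eq_empty_or_nonempty with h | h
  · exact Or.inl h
  · exact Or.inr (R.isIdeal_inner.1.exists_maximal h)

theorem Slide.ncard_inner_lt {R R' : SkewPartition A} (h : R.Slide R') :
    R'.inner.ncard < R.inner.ncard := by
  obtain ⟨H, Q, Q', ⟨hH, -, hi, -, -⟩, hm, -, -, hi', -⟩ := h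
  rw [hi', (HoledSkewPartition.outer_inner_eq_of_moves hm).2, hi]
  exact Set.ncard_sdiff_singleton_lt_of_mem hH.1 R.isIdeal_inner.1

theorem exists_reaches_isPartition (R : SkewPartition A) : ∃ T, T.IsPartition ∧ R.Reaches T := by
  induction hn : R.inner.ncard using Nat.strong_induction_on generalizing R with
  | _ n ih =>
    rcases R.isPartition_or_exists_maximal with h | ⟨H, hH⟩
    · exact ⟨R, h, .refl⟩
    obtain ⟨R', hR', -⟩ := existsUnique_slideAt hH
    have hs : R.Slide R' := ⟨H, hR'⟩
    obtain ⟨T, hT, hr⟩ := ih _ (hn ▸ hs.ncard_inner_lt) R' rfl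
    exact ⟨T, hT, Relation.ReflTransGen.head hs hr⟩

theorem not_exists_infinite_run (R : SkewPartition A) :
    ¬ ∃ s : ℕ → SkewPartition A, s 0 = R ∧ ∀ n, (s n).Slide (s (n + 1)) := by
  rintro ⟨s, -, hs⟩
  obtain ⟨n, hn⟩ := (wellFounded_lt (α := ℕ)).has_min (Set.range fun n => (s n).inner.ncard)
    (Set.range_nonempty _)
  obtain ⟨⟨k, rfl⟩, hk⟩ := hn
  exact hk _ ⟨k + 1, rfl⟩ (hs k).ncard_inner_lt

theorem Slide.outer_subset {R R' : SkewPartition A} (h : R.Slide R') : R'.outer ⊆ R.outer := by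
  obtain ⟨H, Q, Q', ⟨-, ho, -, -, -⟩, hm, -, ho', -, -⟩ := h
  rw [ho', (HoledSkewPartition.outer_inner_eq_of_moves hm).1, ho]
  exact Set.sdiff_subset

theorem Reaches.outer_subset {R R' : SkewPartition A} (h : R.Reaches R') :
    R'.outer ⊆ R.outer := by
  induction h with
  | refl => exact subset_rfl
  | tail _ h ih => exact h.outer_subset.trans ih

theorem Slide.rectifyRows_eq [Fintype A] {R R' : SkewPartition A} (h : R.Slide R') {n : ℕ}
    (hn : ∀ p ∈ R.outer, (p.y : ℕ) ≤ n) :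
    rectifyRows n (rowLabels R'.label) = rectifyRows n (rowLabels R.label) := by
  obtain ⟨H, Q, Q', ⟨-, ho, -, -, hl⟩, hm, -, -, -, hl'⟩ := h
  rw [hl', ← hl]
  clear hl'
  induction hm with
  | refl => rfl
  | tail hm h ih =>
    rw [← ih]
    exact h.rectifyRows_eq (by rwa [(HoledSkewPartition.outer_inner_eq_of_moves hm).1, ho])

theorem Reaches.rectifyRows_eq [Fintype A] {R R' : SkewPartition A} (h : R.Reaches R') {n : ℕ}
    (hn : ∀ p ∈ R.outer, (p.y : ℕ) ≤ n) :
    rectifyRows n (rowLabels R'.label) = rectifyRows n (rowLabels R.label) := by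
  induction h with
  | refl => rfl
  | tail hr h ih =>
    rw [← ih]
    exact h.rectifyRows_eq fun p hp => hn p (Reaches.outer_subset hr hp)

theorem IsPartition.rectifyRows_eq [Fintype A] {T : SkewPartition A} (hT : T.IsPartition) (n : ℕ) :
    rectifyRows n (rowLabels T.label) = List.ofFn fun i : Fin n => rowLabels T.label i := by
  refine rectifyRows_of_min_le (fun i => ?_) n
  refine rowLabels_min_le (j := 0) (I := T.inner) (h := ∅) T.isIdeal_outer.2 ?_ (fun i _ => ?_)
    i.zero_le
  · simpa using T.isLabelling
  · rw [show T.inner = ∅ from hT]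
    exact ⟨id, id⟩

theorem IsPartition.isLabelling_outer {T : SkewPartition A} (hT : T.IsPartition) :
    IsLabelling T.outer T.label := by
  have := T.isLabelling
  rwa [show T.inner = ∅ from hT, Set.sdiff_empty] at this

theorem IsPartition.eq_of_label_eq {T T' : SkewPartition A} (hT : T.IsPartition)
    (hT' : T'.IsPartition) (h : T.label = T'.label) : T = T' := by
  refine SkewPartition.ext (Set.ext fun p => ?_) (hT.trans hT'.symm) h
  rw [hT.isLabelling_outer.domain, hT'.isLabelling_outer.domain, h]

theorem rowLabels_eq_empty [Fintype A] {R : SkewPartition A} {n i : ℕ}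
    (hn : ∀ p ∈ R.outer, (p.y : ℕ) ≤ n) (hi : n ≤ i) : rowLabels R.label i = ∅ := by
  refine Finset.eq_empty_of_forall_notMem fun a ha => ?_
  obtain ⟨x, hx⟩ := mem_rowLabels.1 ha
  have := hn _ (R.isLabelling.mem hx).1
  simp only [Nat.succPNat_coe] at this
  omega

theorem eq_of_reaches [Finite A] {R₀ R T₀ T : SkewPartition A} (h : R₀.label = R.label)
    (hT₀ : T₀.IsPartition) (hr₀ : R₀.Reaches T₀) (hT : T.IsPartition) (hr : R.Reaches T) :
    T₀ = T := by
  have := Fintype.ofFinite A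
  -- The outer ideals may differ although the labels agree, so one bound on the rows is taken for
  -- both; it persists along the runs because slides shrink the outer ideal.
  obtain ⟨n, hn⟩ := ((R₀.isIdeal_outer.1.union R.isIdeal_outer.1).image
    fun p : PosPair => (p.y : ℕ)).bddAbove
  have hn₀ : ∀ p ∈ R₀.outer, (p.y : ℕ) ≤ n := fun p hp => hn ⟨p, Or.inl hp, rfl⟩
  have hn₁ : ∀ p ∈ R.outer, (p.y : ℕ) ≤ n := fun p hp => hn ⟨p, Or.inr hp, rfl⟩
  have key := (hr₀.rectifyRows_eq hn₀).trans
    ((congrArg (fun f => rectifyRows n (rowLabels f)) h).trans (hr.rectifyRows_eq hn₁).symm)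
  rw [hT₀.rectifyRows_eq, hT.rectifyRows_eq] at key
  have key := List.ofFn_injective key
  refine hT₀.eq_of_label_eq hT (eq_of_rowLabels_eq T₀.isIdeal_outer.2 T.isIdeal_outer.2
    hT₀.isLabelling_outer hT.isLabelling_outer fun i => ?_)
  rcases lt_or_ge i n with hi | hi
  · exact congrFun key ⟨i, hi⟩
  · rw [rowLabels_eq_empty (fun p hp => hn₀ p (hr₀.outer_subset hp)) hi,
      rowLabels_eq_empty (fun p hp => hn₁ p (hr.outer_subset hp)) hi]

end SkewPartition

theorem theorem8p6 {A : Type*} [LinearOrder A] [Finite A] (R : SkewPartition A) :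
    -- the algorithm never gets stuck: every choice of a starting point gives a completed slide
    (∀ R' : SkewPartition A, R.Reaches R' →
      (R'.IsPartition ∨ ∃ H, Maximal (· ∈ R'.inner) H) ∧
      ∀ H, Maximal (· ∈ R'.inner) H → ∃! R'' : SkewPartition A, SkewPartition.SlideAt H R' R'') ∧
    -- the algorithm stops, whatever the choices
    (¬ ∃ s : ℕ → SkewPartition A, s 0 = R ∧ ∀ n, (s n).Slide (s (n + 1))) ∧
    -- there is exactly one partition that can be obtained
    (∃! T : SkewPartition A, T.IsPartition ∧ R.Reaches T) ∧
    -- it depends only on the labelled set, not on how it is written as a difference of ideals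
    (∀ R₀ T₀ T : SkewPartition A, R₀.label = R.label → T₀.IsPartition → R₀.Reaches T₀ →
      T.IsPartition → R.Reaches T → T₀ = T) := by
  refine ⟨fun R' _ => ⟨R'.isPartition_or_exists_maximal, fun H hH =>
    SkewPartition.existsUnique_slideAt hH⟩, R.not_exists_infinite_run, ?_,
    fun R₀ T₀ T h hT₀ hr₀ hT hr => SkewPartition.eq_of_reaches h hT₀ hr₀ hT hr⟩
  obtain ⟨T, hT, hr⟩ := R.exists_reaches_isPartition
  exact ⟨T, ⟨hT, hr⟩, fun T' h => SkewPartition.eq_of_reaches rfl h.1 h.2 hT hr⟩
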